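/- Let $t$ be an indeterminate, and let $y_1,\dots,y_n\in t\mathbf{C}[[t]]$ be formal power series with zero constant term that are linearly independent over $\mathbf{Q}$. For $y\in t\mathbf{C}[[t]]$ write $e^{y}=\sum_{k\ge 0} y^k/k!\in\mathbf{C}[[t]]$, and regard $\mathbf{C}[[t]]$ and the field of rational functions $\mathbf{C}(t)$ as subrings of the field of formal Laurent series $\mathbf{C}((t))$. Then the subfield $\mathbf{C}(t)(y_1,\dots,y_n,e^{y_1},\dots,e^{y_n})$ of $\mathbf{C}((t))$ satisfies $$\operatorname{trdeg}_{\mathbf{C}(t)}\ \mathbf{C}(t)(y_1,\dots,y_n,e^{y_1},\dots,e^{y_n})\ \ge\ n.$$ -/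

import Mathlib

/-- `ℂ((t))` as an extension of `ℂ(t)`: the unique extension to fractions of the inclusion
`ℂ[t] → ℂ((t))`. -/
noncomputable instance ratFuncAlgebraLaurentSeries : Algebra (RatFunc ℂ) (LaurentSeries ℂ) :=
  RatFunc.liftAlgebra ℂ (LaurentSeries ℂ)

/-- `e^y` for a formal power series `y` with zero constant term: the series obtained by
substituting `y` into `∑ Xᵏ / k!`. -/
noncomputable def expSeries (y : PowerSeries ℂ) : PowerSeries ℂ :=
  (PowerSeries.exp ℂ).subst y

/-!
The proof is a derivation-theoretic form of Ax's argument. Let `K ⊇ F` be fields of characteristic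
zero, `D` an `F`-derivation of `K` whose only constants are the elements of `F`, and `yᵢ, zᵢ` (for
`i` in a finite set `ι`) elements of a subfield `K₀` with `D zᵢ = zᵢ D yᵢ`. Here `F = ℂ`,
`K = ℂ((t))`, `D = d/dt`, `zᵢ = exp yᵢ`, and `K₀` is generated by `t` and the `yᵢ, zᵢ`; note that
`K₀` need not be stable under `D`.

If the transcendence degree of `K₀` over `F` were at most `n = |ι|`, consider the map `Φ` sending an
`F`-derivation `δ` of `K` to the vector `(δ yᵢ - δ zᵢ / zᵢ)ᵢ` in `Kⁿ`. It factors through the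
restriction of `δ` to `K₀`, hence through a space of dimension at most `n`, and it kills `D`, which
is nonzero on `K₀` because `D t = 1`. So its image is a proper subspace
(`finrank_range_logDifferential_lt`). Since `Φ ⁅D, δ⁆ = D (Φ δ)` (`logDifferential_lie`), the linear
relations satisfied by the image are stable under `D`, so some nonzero relation has constant
coefficients (`exists_constant_vector`): there are `cᵢ ∈ F`, not all zero, with
`∑ cᵢ δ zᵢ / zᵢ = δ (∑ cᵢ yᵢ)` for all `δ`.

Choose a `ℚ`-linear functional on `F` that is nonzero at some `cᵢ`, and scale its values at the `cᵢ`
to integers `mᵢ`. Then `u = ∏ zᵢ ^ mᵢ` is algebraic over `F`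
(`exists_int_isAlgebraic_prod_zpow`). Otherwise `u` belongs to a transcendence basis of `K`, so that
`K` is algebraic over `k(u)` for a field `k ⊇ F` over which `u` is transcendental, and `K` embeds
into an algebraic closure of `k((X))` with `u ↦ X`. The trace down to `k((X))` followed by the residue
kills exact derivatives and sends logarithmic derivatives `δ zᵢ / zᵢ` to integers `νᵢ`, so
`∑ cᵢ νᵢ = 0` and therefore `∑ mᵢ νᵢ = 0`; but it sends `δ u / u = 1 / X` to the degree of a finite
extension, which is not zero (`exists_int_residues_of_transcendental`).

Being algebraic over `F`, `u` is a constant, so `∑ mᵢ D yᵢ = D u / u = 0`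
(`exists_int_combination_constant`). For power series `yᵢ` with zero constant term this says that
`∑ mᵢ yᵢ = 0`, contradicting linear independence.
-/

/-! ### Extension of derivations -/

/-- Derivations extend along formally étale maps, because `B ⊗[A] Ω[A⁄R] ≃ Ω[B⁄R]`. -/
theorem Derivation.exists_extension_of_formallyEtale {R A B : Type*} [CommRing R] [CommRing A]
    [CommRing B] [Algebra R A] [Algebra R B] [Algebra A B] [IsScalarTower R A B]
    [Algebra.FormallyEtale A B] (d : Derivation R A A) :
    ∃ d' : Derivation R B B, ∀ a, d' (algebraMap A B a) = algebraMap A B (d a) := by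
  let dB : Derivation R A B := (Algebra.linearMap A B).compDer d
  let f : B →ₗ[B] B := LinearMap.id
  refine ⟨((dB.liftKaehlerDifferential.liftBaseChange B).comp
    (KaehlerDifferential.tensorKaehlerEquivOfFormallyEtale R A B).symm.toLinearMap).compDer
      (KaehlerDifferential.D R B), fun a => ?_⟩
  simp [KaehlerDifferential.tensorKaehlerEquivOfFormallyEtale_symm_D_algebraMap, dB]

/-- An algebra map out of a formally unramified `A`-algebra intertwines two derivations as soon as
it does so on `A`. -/
theorem Derivation.comp_algHom_eq_of_formallyUnramified {R A B M : Type*} [CommRing R] [CommRing A]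
    [CommRing B] [CommRing M] [Algebra R A] [Algebra R B] [Algebra A B] [IsScalarTower R A B]
    [Algebra R M] [Algebra.FormallyUnramified A B]
    (d : Derivation R B B) (d' : Derivation R M M) (σ : B →ₐ[R] M)
    (h : ∀ a, σ (d (algebraMap A B a)) = d' (σ (algebraMap A B a))) (b : B) :
    σ (d b) = d' (σ b) := by
  let := σ.toRingHom.toAlgebra
  let : Algebra A M := (σ.toRingHom.comp (algebraMap A B)).toAlgebra
  have : IsScalarTower R B M := .of_algebraMap_eq fun r => (σ.commutes r).symm
  have : IsScalarTower A B M := .of_algebraMap_eq fun r => rfl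
  have : IsScalarTower R A M := .of_algebraMap_eq fun r => by
    rw [IsScalarTower.algebraMap_apply A B M, ← IsScalarTower.algebraMap_apply R A B,
      ← IsScalarTower.algebraMap_apply R B M]
  -- The defect of commutation is a derivation that vanishes on `A`, hence is `A`-linear, and so it
  -- factors through `Ω[B⁄A] = 0`.
  let e : Derivation R B M := (Algebra.linearMap B M).compDer d - d'.compAlgebraMap B
  have he (b) : e b = σ (d b) - d' (σ b) := rfl
  have he0 (a : A) : e (algebraMap A B a) = 0 := by rw [he, h, sub_self]
  let e' : Derivation A B M := Derivation.mk'
    { toFun := e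
      map_add' := map_add e
      map_smul' := fun a b => by
        rw [Algebra.smul_def, Derivation.leibniz, he0, smul_zero, add_zero]
        exact algebraMap_smul B a (e b) }
    (fun a b => e.leibniz a b)
  have h0 : e' b = 0 := by
    have : (KaehlerDifferential.D A B) b = 0 := Subsingleton.elim _ _
    rw [← e'.liftKaehlerDifferential_comp_D, this, map_zero]
  exact sub_eq_zero.mp h0

theorem Algebra.FormallyEtale.of_isAlgebraic_of_charZero (A K : Type*) [CommRing A] [IsDomain A]
    [CharZero A] [Field K] [Algebra A K] [FaithfulSMul A K] [Algebra.IsAlgebraic A K] :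
    Algebra.FormallyEtale A K := by
  let := FractionRing.liftAlgebra A K
  have : Algebra.IsAlgebraic (FractionRing A) K :=
    (IsFractionRing.comap_isAlgebraic_iff (A := A) (K := FractionRing A) (C := K)).mp inferInstance
  have : CharZero (FractionRing A) := charZero_of_injective_algebraMap
    (IsFractionRing.injective A (FractionRing A))
  have : Algebra.FormallyEtale A (FractionRing A) := .of_isLocalization (nonZeroDivisors A)
  have : Algebra.FormallyEtale (FractionRing A) K := .of_isSeparable _ _
  exact .comp A (FractionRing A) K

/-! ### Logarithmic derivatives -/

theorem Derivation.div_self_zpow {R K : Type*} [CommRing R] [Field K] [Algebra R K]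
    (d : Derivation R K K) {x : K} (hx : x ≠ 0) (n : ℤ) : d (x ^ n) / x ^ n = n * (d x / x) := by
  rw [Derivation.leibniz_zpow]
  have := zpow_ne_zero n hx
  rw [zpow_sub_one₀ hx]
  simp
  field_simp

theorem Derivation.div_self_mul {R K : Type*} [CommRing R] [Field K] [Algebra R K]
    (d : Derivation R K K) {x y : K} (hx : x ≠ 0) (hy : y ≠ 0) :
    d (x * y) / (x * y) = d x / x + d y / y := by
  simp only [Derivation.leibniz, smul_eq_mul]
  field_simp
  ring

theorem Derivation.div_self_prod {R K ι : Type*} [CommRing R] [Field K] [Algebra R K]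
    (d : Derivation R K K) (s : Finset ι) {x : ι → K} (hx : ∀ i, x i ≠ 0) :
    d (∏ i ∈ s, x i) / (∏ i ∈ s, x i) = ∑ i ∈ s, d (x i) / x i := by
  classical
  induction s using Finset.induction_on with
  | empty => simp
  | insert a s ha ih =>
    rw [Finset.prod_insert ha, Finset.sum_insert ha, div_self_mul d (hx a)
      (Finset.prod_ne_zero_iff.mpr fun i _ => hx i), ih]

/-! ### Residues of Laurent series -/

open scoped LaurentSeries

/-- The field of fractions of `k⟦X⟧` is the field of Laurent series. The residue calculus
is carried out in the former, whose `k`-module structure is the one given by its `k`-algebra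
structure; the latter serves to read off coefficients. -/
noncomputable def fractionRingPowerSeriesEquiv (k : Type*) [Field k] :
    FractionRing (PowerSeries k) ≃ₐ[PowerSeries k] k⸨X⸩ :=
  FractionRing.algEquiv (PowerSeries k) k⸨X⸩

section Residue

variable {k : Type*} [Field k]

local notation "E" => FractionRing (PowerSeries k)

theorem fractionRingPowerSeriesEquiv_algebraMap (g : PowerSeries k) :
    fractionRingPowerSeriesEquiv k (algebraMap (PowerSeries k) E g) = (g : k⸨X⸩) :=
  (fractionRingPowerSeriesEquiv k).commutes g

theorem algebraMap_X_ne_zero : algebraMap (PowerSeries k) E PowerSeries.X ≠ 0 := by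
  rw [Ne, FaithfulSMul.algebraMap_eq_zero_iff]
  exact PowerSeries.X_ne_zero

theorem fractionRingPowerSeriesEquiv_X_zpow (n : ℤ) :
    fractionRingPowerSeriesEquiv k (algebraMap (PowerSeries k) E PowerSeries.X ^ n) =
      HahnSeries.single n 1 := by
  rw [map_zpow₀, fractionRingPowerSeriesEquiv_algebraMap, PowerSeries.coe_X]
  exact (RatFunc.single_zpow n).symm

theorem exists_eq_X_zpow_mul (f : E) : ∃ (n : ℤ) (g : PowerSeries k),
    f = algebraMap (PowerSeries k) E PowerSeries.X ^ n * algebraMap (PowerSeries k) E g ∧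
      (f ≠ 0 → PowerSeries.constantCoeff g ≠ 0) := by
  refine ⟨(fractionRingPowerSeriesEquiv k f).order,
    (fractionRingPowerSeriesEquiv k f).powerSeriesPart, ?_, fun hf => ?_⟩
  · apply (fractionRingPowerSeriesEquiv k).injective
    rw [map_mul, fractionRingPowerSeriesEquiv_X_zpow, fractionRingPowerSeriesEquiv_algebraMap,
      LaurentSeries.single_order_mul_powerSeriesPart]
  · rw [← PowerSeries.coeff_zero_eq_constantCoeff_apply, LaurentSeries.powerSeriesPart_coeff]
    simpa using hf

/-- The residue at `X = 0`: the coefficient of `X⁻¹`. -/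
noncomputable def powerSeriesResidue (k : Type*) [Field k] :
    FractionRing (PowerSeries k) →ₗ[k] k where
  toFun f := (fractionRingPowerSeriesEquiv k f).coeff (-1)
  map_add' f g := by rw [map_add, HahnSeries.coeff_add]
  map_smul' c f := by
    rw [Algebra.smul_def, map_mul, IsScalarTower.algebraMap_apply k (PowerSeries k),
      fractionRingPowerSeriesEquiv_algebraMap, ← PowerSeries.C_eq_algebraMap,
      PowerSeries.coe_C, HahnSeries.C_apply, HahnSeries.coeff_single_zero_mul]
    rfl

theorem powerSeriesResidue_X_zpow_mul (n : ℤ) (g : PowerSeries k) :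
    powerSeriesResidue k
        (algebraMap (PowerSeries k) E PowerSeries.X ^ n * algebraMap (PowerSeries k) E g) =
      if 0 ≤ -1 - n then PowerSeries.coeff (-1 - n).natAbs g else 0 := by
  change (fractionRingPowerSeriesEquiv k _).coeff (-1) = _
  rw [map_mul, fractionRingPowerSeriesEquiv_X_zpow, fractionRingPowerSeriesEquiv_algebraMap,
    HahnSeries.coeff_single_mul, one_mul, PowerSeries.coeff_coe]
  split_ifs <;> first | rfl | omega

variable (k) in
/-- The derivation `d/dX` of the field of Laurent series. -/
theorem exists_derivation_fractionRing_powerSeries : ∃ d : Derivation k E E, ∀ g : PowerSeries k,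
    d (algebraMap (PowerSeries k) E g) =
      algebraMap (PowerSeries k) E (PowerSeries.derivative k g) := by
  have : Algebra.FormallyEtale (PowerSeries k) E :=
    .of_isLocalization (nonZeroDivisors (PowerSeries k))
  exact Derivation.exists_extension_of_formallyEtale (PowerSeries.derivative k)

theorem powerSeriesResidue_derivation {d : Derivation k E E}
    (hd : ∀ g : PowerSeries k,
      d (algebraMap (PowerSeries k) E g) =
        algebraMap (PowerSeries k) E (PowerSeries.derivative k g)) (f : E) :
    powerSeriesResidue k (d f) = 0 := by
  obtain ⟨n, g, rfl, -⟩ := exists_eq_X_zpow_mul f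
  have h1 : d (algebraMap (PowerSeries k) E PowerSeries.X ^ n * algebraMap (PowerSeries k) E g) =
      algebraMap (PowerSeries k) E PowerSeries.X ^ n *
        algebraMap (PowerSeries k) E (PowerSeries.derivative k g) +
      (n : k) • (algebraMap (PowerSeries k) E PowerSeries.X ^ (n - 1) *
        algebraMap (PowerSeries k) E g) := by
    rw [Derivation.leibniz, Derivation.leibniz_zpow, hd, hd, PowerSeries.derivative_X, map_one,
      Algebra.smul_def (n : k), map_intCast]
    simp only [smul_eq_mul, mul_one, zsmul_eq_mul]
    ring
  rw [h1, map_add, map_smul, powerSeriesResidue_X_zpow_mul, powerSeriesResidue_X_zpow_mul]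
  -- For `n < 0` the coefficient of `X ^ (-n - 1)` in `g'` cancels against the second term.
  obtain h | h | h : 0 ≤ -1 - n ∨ n = 0 ∨ 0 < n := by omega
  · rw [if_pos h, if_pos (by omega), PowerSeries.coeff_derivative]
    have h2 : (-1 - (n - 1)).natAbs = (-1 - n).natAbs + 1 := by omega
    have h3 : (n : k) = -(((-1 - n).natAbs : k) + 1) := by
      have h4 : n = -(((-1 - n).natAbs : ℤ) + 1) := by omega
      generalize (-1 - n).natAbs = j at h4
      rw [h4, Int.cast_neg, Int.cast_add, Int.cast_natCast, Int.cast_one]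
    rw [h2, h3, smul_eq_mul]
    ring
  · subst h
    simp
  · rw [if_neg (by omega), if_neg (by omega), smul_zero, add_zero]

/-- The residue of a logarithmic derivative is the order of vanishing. -/
theorem powerSeriesResidue_div_self {d : Derivation k E E}
    (hd : ∀ g : PowerSeries k,
      d (algebraMap (PowerSeries k) E g) =
        algebraMap (PowerSeries k) E (PowerSeries.derivative k g))
    (n : ℤ) {g : PowerSeries k} (hg : PowerSeries.constantCoeff g ≠ 0) :
    powerSeriesResidue k (d (algebraMap (PowerSeries k) E PowerSeries.X ^ n *
      algebraMap (PowerSeries k) E g) / (algebraMap (PowerSeries k) E PowerSeries.X ^ n *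
      algebraMap (PowerSeries k) E g)) = n := by
  have hX := algebraMap_X_ne_zero (k := k)
  have hg1 : algebraMap (PowerSeries k) E g ≠ 0 := by
    rw [Ne, FaithfulSMul.algebraMap_eq_zero_iff]
    rintro rfl
    exact hg (map_zero _)
  have hinv : (algebraMap (PowerSeries k) E g)⁻¹ = algebraMap (PowerSeries k) E g⁻¹ := by
    refine inv_eq_of_mul_eq_one_right ?_
    rw [← map_mul, PowerSeries.mul_inv_cancel _ hg, map_one]
  have h1 : d (algebraMap (PowerSeries k) E PowerSeries.X ^ n * algebraMap (PowerSeries k) E g) /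
      (algebraMap (PowerSeries k) E PowerSeries.X ^ n * algebraMap (PowerSeries k) E g) =
      (n : k) • (algebraMap (PowerSeries k) E PowerSeries.X ^ (-1 : ℤ) *
        algebraMap (PowerSeries k) E 1) +
      algebraMap (PowerSeries k) E PowerSeries.X ^ (0 : ℤ) *
        algebraMap (PowerSeries k) E (PowerSeries.derivative k g * g⁻¹) := by
    rw [Derivation.div_self_mul d (zpow_ne_zero n hX) hg1, Derivation.div_self_zpow d hX, hd,
      hd, PowerSeries.derivative_X, div_eq_mul_inv _ (algebraMap (PowerSeries k) E g), hinv,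
      map_mul, Algebra.smul_def (n : k), map_intCast]
    simp
  rw [h1, map_add, map_smul, powerSeriesResidue_X_zpow_mul, powerSeriesResidue_X_zpow_mul]
  simp

theorem exists_powerSeriesResidue_div_self_eq {d : Derivation k E E}
    (hd : ∀ g : PowerSeries k,
      d (algebraMap (PowerSeries k) E g) =
        algebraMap (PowerSeries k) E (PowerSeries.derivative k g))
    {f : E} (hf : f ≠ 0) : ∃ n : ℤ, powerSeriesResidue k (d f / f) = n := by
  obtain ⟨n, g, rfl, hg⟩ := exists_eq_X_zpow_mul f
  exact ⟨n, powerSeriesResidue_div_self hd n (hg hf)⟩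

/-- In characteristic zero the constants of `d/dX` are the elements of the coefficient field: the
residue of `d f / f = 0` shows that `f` has order zero. -/
theorem exists_algebraMap_eq_of_derivation_eq_zero [CharZero k] {d : Derivation k E E}
    (hd : ∀ g : PowerSeries k,
      d (algebraMap (PowerSeries k) E g) =
        algebraMap (PowerSeries k) E (PowerSeries.derivative k g))
    {f : E} (hf : d f = 0) : ∃ c, algebraMap k E c = f := by
  by_cases hf0 : f = 0
  · exact ⟨0, by rw [hf0, map_zero]⟩
  obtain ⟨n, g, rfl, hg⟩ := exists_eq_X_zpow_mul f
  have hn := powerSeriesResidue_div_self hd n (hg hf0)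
  rw [hf, zero_div, map_zero, eq_comm, Int.cast_eq_zero] at hn
  subst hn
  rw [zpow_zero, one_mul, hd, FaithfulSMul.algebraMap_eq_zero_iff] at hf
  refine ⟨PowerSeries.constantCoeff g, ?_⟩
  rw [zpow_zero, one_mul, IsScalarTower.algebraMap_apply k (PowerSeries k)]
  congr 1
  apply PowerSeries.derivative.ext
  · rw [hf, ← PowerSeries.C_eq_algebraMap, PowerSeries.derivative_C]
  · simp

theorem powerSeriesResidue_X_inv :
    powerSeriesResidue k (algebraMap (PowerSeries k) E PowerSeries.X)⁻¹ = 1 := by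
  have := powerSeriesResidue_X_zpow_mul (-1) (1 : PowerSeries k)
  simpa using this

end Residue

/-! ### Derivations, trace and norm -/

section TraceNorm

variable {k F N : Type*} [Field k] [Field F] [CharZero F] [Field N] [Algebra k F] [Algebra F N]
  [Algebra k N] [IsScalarTower k F N]

theorem Derivation.exists_extension_of_isAlgebraic [Algebra.IsAlgebraic F N]
    (d : Derivation k F F) :
    ∃ d' : Derivation k N N, ∀ a, d' (algebraMap F N a) = algebraMap F N (d a) :=
  have := Algebra.FormallyEtale.of_isAlgebraic_of_charZero F N
  exists_extension_of_formallyEtale d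

theorem Derivation.algHom_comp_eq_of_isAlgebraic [Algebra.IsAlgebraic F N] {M : Type*} [Field M]
    [Algebra F M] [Algebra k M] [IsScalarTower k F M] {d : Derivation k F F}
    {dN : Derivation k N N} (hN : ∀ a, dN (algebraMap F N a) = algebraMap F N (d a))
    {dM : Derivation k M M} (hM : ∀ a, dM (algebraMap F M a) = algebraMap F M (d a))
    (σ : N →ₐ[F] M) (b : N) : σ (dN b) = dM (σ b) := by
  have := Algebra.FormallyEtale.of_isAlgebraic_of_charZero F N
  exact comp_algHom_eq_of_formallyUnramified (A := F) dN dM (σ.restrictScalars k)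
    (fun a => by simp [hN, hM]) b

variable [FiniteDimensional F N]

/-- The trace commutes with derivations: it is the sum over all embeddings into an algebraic
closure, and these commute with the extended derivation. -/
theorem Derivation.trace_apply {d : Derivation k F F}
    {dN : Derivation k N N} (hN : ∀ a, dN (algebraMap F N a) = algebraMap F N (d a)) (b : N) :
    Algebra.trace F N (dN b) = d (Algebra.trace F N b) := by
  obtain ⟨dM, hM⟩ := d.exists_extension_of_isAlgebraic (N := AlgebraicClosure F)
  apply (algebraMap F (AlgebraicClosure F)).injective
  rw [← hM, trace_eq_sum_embeddings, trace_eq_sum_embeddings, map_sum]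
  exact Finset.sum_congr rfl fun σ _ => algHom_comp_eq_of_isAlgebraic hN hM σ b

/-- The trace of a logarithmic derivative is the logarithmic derivative of the norm. -/
theorem Derivation.trace_div_self {d : Derivation k F F}
    {dN : Derivation k N N} (hN : ∀ a, dN (algebraMap F N a) = algebraMap F N (d a)) {b : N}
    (hb : b ≠ 0) :
    Algebra.trace F N (dN b / b) = d (Algebra.norm F b) / Algebra.norm F b := by
  obtain ⟨dM, hM⟩ := d.exists_extension_of_isAlgebraic (N := AlgebraicClosure F)
  apply (algebraMap F (AlgebraicClosure F)).injective
  rw [map_div₀ (algebraMap F (AlgebraicClosure F)), ← hM, trace_eq_sum_embeddings,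
    Algebra.norm_eq_prod_embeddings,
    dM.div_self_prod _ fun σ : N →ₐ[F] AlgebraicClosure F => (map_ne_zero σ).mpr hb]
  refine Finset.sum_congr rfl fun σ _ => ?_
  rw [map_div₀, algHom_comp_eq_of_isAlgebraic hN hM σ b]

end TraceNorm

/-! ### Integrality of residues and multiplicative relations -/

section IntegralResidues

variable {k : Type*} [Field k] [CharZero k]

local notation "E" => FractionRing (PowerSeries k)

instance charZero_fractionRing_powerSeries : CharZero E :=
  charZero_of_injective_algebraMap (algebraMap k E).injective

/-- Over a finite extension `N` of `k((X))`, the functional "trace followed by residue" attaches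
integers `νᵢ` to the logarithmic derivatives of the `zᵢ`. They satisfy every `k`-linear relation
between these logarithmic derivatives modulo exact derivatives, and `∑ mᵢ νᵢ ≠ 0` whenever
`∏ zᵢ ^ mᵢ` equals `X`. -/
theorem exists_int_residues_of_finiteDimensional {N ι : Type*} [Field N] [Algebra E N] [Algebra k N]
    [IsScalarTower k E N] [FiniteDimensional E N] [Fintype ι] {d : Derivation k E E}
    (hd : ∀ g : PowerSeries k,
      d (algebraMap (PowerSeries k) E g) =
        algebraMap (PowerSeries k) E (PowerSeries.derivative k g))
    {dN : Derivation k N N} (hN : ∀ a, dN (algebraMap E N a) = algebraMap E N (d a))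
    {z : ι → N} (hz : ∀ i, z i ≠ 0) {v : N} {c : ι → k}
    (h : ∑ i, c i • (dN (z i) / z i) = dN v) :
    ∃ ν : ι → ℤ, ∑ i, c i * ν i = 0 ∧ ∀ m : ι → ℤ,
      algebraMap E N (algebraMap (PowerSeries k) E PowerSeries.X) = ∏ i, z i ^ m i →
        ∑ i, m i * ν i ≠ 0 := by
  let τ : N →ₗ[k] k :=
    (powerSeriesResidue k).comp ((Algebra.trace E N).restrictScalars k)
  have hτ (b : N) : τ b = powerSeriesResidue k (Algebra.trace E N b) := rfl
  have h1 (i) : ∃ n : ℤ, τ (dN (z i) / z i) = n := by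
    rw [hτ, Derivation.trace_div_self hN (hz i)]
    exact exists_powerSeriesResidue_div_self_eq hd (by
      rw [Ne, Algebra.norm_eq_zero_iff]
      exact hz i)
  choose ν hν using h1
  refine ⟨ν, ?_, fun m hm h0 => ?_⟩
  · have := congrArg τ h
    rw [hτ (dN v), Derivation.trace_apply hN, powerSeriesResidue_derivation hd, map_sum] at this
    simpa [hν] using this
  · have h2 := dN.div_self_prod Finset.univ (x := fun i => z i ^ m i)
      (fun i => zpow_ne_zero _ (hz i))
    rw [← hm, hN, hd, PowerSeries.derivative_X, ← map_div₀, map_one, one_div] at h2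
    have h3 := congrArg τ h2
    simp only [fun i => Derivation.div_self_zpow dN (hz i) (m i)] at h3
    rw [hτ, Algebra.trace_algebraMap, map_nsmul, powerSeriesResidue_X_inv, map_sum] at h3
    have h4 (i) : τ ((m i : N) * (dN (z i) / z i)) = m i * ν i := by
      rw [← zsmul_eq_mul, map_zsmul, hν, zsmul_eq_mul]
    simp only [h4] at h3
    have h5 : (∑ i, (m i : k) * ν i) = ((∑ i, m i * ν i : ℤ) : k) := by push_cast; rfl
    rw [h5, h0] at h3
    have : Module.finrank E N ≠ 0 := Module.finrank_pos.ne'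
    simp [this] at h3

open Polynomial in
/-- The same for an algebraic extension `K` of `k(X)`, possibly of infinite degree: embed `K` into
an algebraic closure of `k((X))` and pass to the finite extension generated by the elements
involved. -/
theorem exists_int_residues {K ι : Type*} [Field K] [Algebra k[X] K] [Algebra k K]
    [IsScalarTower k k[X] K] [FaithfulSMul k[X] K] [Algebra.IsAlgebraic k[X] K] [Fintype ι]
    {δ : Derivation k K K}
    (hδ : ∀ p : k[X], δ (algebraMap k[X] K p) = algebraMap k[X] K (derivative p))
    {z : ι → K} (hz : ∀ i, z i ≠ 0) {v : K} {c : ι → k}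
    (h : ∑ i, c i • (δ (z i) / z i) = δ v) :
    ∃ ν : ι → ℤ, ∑ i, c i * ν i = 0 ∧ ∀ m : ι → ℤ,
      algebraMap k[X] K X = ∏ i, z i ^ m i → ∑ i, m i * ν i ≠ 0 := by
  let M := AlgebraicClosure E
  obtain ⟨d, hd⟩ := exists_derivation_fractionRing_powerSeries k
  obtain ⟨dM, hM⟩ := d.exists_extension_of_isAlgebraic (N := M)
  have : FaithfulSMul k[X] M := by
    rw [faithfulSMul_iff_algebraMap_injective, IsScalarTower.algebraMap_eq k[X] (PowerSeries k) M,
      IsScalarTower.algebraMap_eq (PowerSeries k) E M]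
    exact ((algebraMap E M).injective.comp (IsFractionRing.injective _ _)).comp
      (Polynomial.coe_injective k)
  have : CharZero k[X] := charZero_of_injective_algebraMap (Polynomial.C_injective)
  have := Algebra.FormallyEtale.of_isAlgebraic_of_charZero k[X] K
  have hpoly (p : k[X]) : algebraMap k[X] M p =
      algebraMap E M (algebraMap (PowerSeries k) E (p : PowerSeries k)) := rfl
  let φ : K →ₐ[k[X]] M := IsAlgClosed.lift
  let φ' : K →ₐ[k] M := φ.restrictScalars k
  have hφ (b : K) : φ' (δ b) = dM (φ' b) := by
    refine Derivation.comp_algHom_eq_of_formallyUnramified (A := k[X]) δ dM φ' (fun p => ?_) b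
    rw [hδ]
    change φ (algebraMap _ _ _) = dM (φ (algebraMap _ _ _))
    rw [φ.commutes, φ.commutes, hpoly, hpoly, hM, hd, PowerSeries.derivative_coe]
  let N : IntermediateField E M :=
    IntermediateField.adjoin E (insert (φ' v) (Set.range fun i => φ' (z i)))
  have hint (b : M) : IsIntegral E b := Algebra.IsIntegral.isIntegral b
  have : Finite ↑(insert (φ' v) (Set.range fun i => φ' (z i))) := inferInstance
  have : FiniteDimensional E N :=
    IntermediateField.finiteDimensional_adjoin fun b _ => hint b
  obtain ⟨dN, hN⟩ := d.exists_extension_of_isAlgebraic (N := N)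
  have hval (b : N) : ((dN b : N) : M) = dM b :=
    Derivation.algHom_comp_eq_of_isAlgebraic hN hM N.val b
  let v' : N := ⟨φ' v, IntermediateField.subset_adjoin _ _ (Set.mem_insert _ _)⟩
  let z' (i : ι) : N := ⟨φ' (z i), IntermediateField.subset_adjoin _ _
    (Set.mem_insert_of_mem _ (Set.mem_range_self i))⟩
  obtain ⟨ν, hν, hm⟩ := exists_int_residues_of_finiteDimensional hd hN (z := z') (v := v') (c := c)
    (fun i h0 => hz i <| (map_eq_zero φ').mp (congrArg Subtype.val h0)) (by
      apply Subtype.val_injective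
      rw [hval]
      change N.val _ = dM (φ' v)
      rw [← hφ, ← h, map_sum, map_sum]
      refine Finset.sum_congr rfl fun i _ => ?_
      rw [map_smul φ', map_div₀ φ', hφ]
      change (c i • (N.val (dN (z' i) / z' i))) = _
      rw [map_div₀]
      change c i • (((dN (z' i) : N) : M) / φ' (z i)) = _
      rw [hval])
  refine ⟨ν, hν, fun m hx => hm m ?_⟩
  apply Subtype.val_injective
  have h1 := congrArg φ' hx
  rw [map_prod] at h1
  simp only [map_zpow₀] at h1
  change algebraMap E M _ = N.val (∏ i, z' i ^ m i)
  rw [map_prod]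
  simp only [map_zpow₀]
  refine Eq.trans ?_ h1
  change _ = φ (algebraMap k[X] K X)
  rw [φ.commutes, hpoly, Polynomial.coe_X]

end IntegralResidues

open Polynomial in
/-- If `∑ cᵢ dlog zᵢ` is exact, then for each transcendental `x` there are integers `νᵢ`
with `∑ cᵢ νᵢ = 0` that obstruct `x` from being a monomial `∏ zᵢ ^ mᵢ` with `∑ mᵢ νᵢ = 0`. -/
theorem exists_int_residues_of_transcendental {F K ι : Type*} [Field F] [CharZero F] [Field K]
    [Algebra F K] [Fintype ι] {x : K} (hx : Transcendental F x) {z : ι → K} (hz : ∀ i, z i ≠ 0)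
    {v : K} {c : ι → F}
    (h : ∀ δ : Derivation F K K, ∑ i, c i • (δ (z i) / z i) = δ v) :
    ∃ ν : ι → ℤ, ∑ i, c i * ν i = 0 ∧ ∀ m : ι → ℤ, x = ∏ i, z i ^ m i → ∑ i, m i * ν i ≠ 0 := by
  obtain ⟨t, hxt, ht⟩ := exists_isTranscendenceBasis_superset (R := F) (s := {x})
    (algebraicIndependent_unique_type_iff.mpr hx)
  have hxt : x ∈ t := hxt rfl
  -- `x` is part of a transcendence basis `t`; the rest of `t` goes into the coefficient field.
  let k := IntermediateField.adjoin F (t \ {x})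
  have hxk : Transcendental k x := by
    rw [IntermediateField.transcendental_adjoin_iff]
    have := ht.1.transcendental_adjoin (s := {⟨x, hxt⟩}ᶜ) (i := ⟨x, hxt⟩) (by simp)
    have hset : (Subtype.val : t → K) '' {⟨x, hxt⟩}ᶜ = t \ {x} := by
      ext b
      constructor
      · rintro ⟨b, hb, rfl⟩
        exact ⟨b.2, fun h => hb (Subtype.ext h)⟩
      · exact fun hb => ⟨⟨b, hb.1⟩, fun h => hb.2 (congrArg Subtype.val h), rfl⟩
    rwa [hset] at this
  let : Algebra k[X] K := (aeval (R := k) x).toAlgebra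
  have hX : algebraMap k[X] K X = x := aeval_X x
  have : IsScalarTower k k[X] K := .of_algebraMap_eq fun a => (aeval_C x a).symm
  have : FaithfulSMul k[X] K := by
    rw [faithfulSMul_iff_algebraMap_injective]
    exact transcendental_iff_injective.mp hxk
  have : Algebra.IsAlgebraic k[X] K := by
    have h1 := ht.isAlgebraic
    rw [Subtype.range_coe] at h1
    have : IsScalarTower F k[X] K := .of_algebraMap_eq fun a => by
      rw [IsScalarTower.algebraMap_apply F k K, IsScalarTower.algebraMap_apply F k k[X],
        ← IsScalarTower.algebraMap_apply k k[X] K]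
    let g := IsScalarTower.toAlgHom F k[X] K
    have hg : Function.Injective g := FaithfulSMul.algebraMap_injective k[X] K
    have hle : Algebra.adjoin F t ≤ g.range := by
      refine Algebra.adjoin_le fun b hb => ?_
      by_cases hbx : b = x
      · exact ⟨X, hX.trans hbx.symm⟩
      · exact ⟨C ⟨b, IntermediateField.subset_adjoin F _ ⟨hb, hbx⟩⟩, aeval_C x _⟩
    let f : Algebra.adjoin F t →ₐ[F] k[X] :=
      (AlgEquiv.ofInjective g hg).symm.toAlgHom.comp (Subalgebra.inclusion hle)
    have hf (b) : algebraMap k[X] K (f b) = b :=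
      congrArg Subtype.val
        ((AlgEquiv.ofInjective g hg).apply_symm_apply (Subalgebra.inclusion hle b))
    refine ⟨fun b => (h1.isAlgebraic b).ringHom_of_comp_eq f (RingHom.id K) (fun a b hab => ?_) ?_⟩
    · apply Subtype.val_injective
      rw [← hf a, ← hf b, hab]
    · ext b
      exact hf b
  have : CharZero k[X] := charZero_of_injective_algebraMap (Polynomial.C_injective)
  have := Algebra.FormallyEtale.of_isAlgebraic_of_charZero k[X] K
  obtain ⟨δ, hδ⟩ := Derivation.exists_extension_of_formallyEtale (B := K)
    (derivative' : Derivation k k[X] k[X])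
  obtain ⟨ν, hν, hm⟩ := exists_int_residues hδ hz (v := v) (c := fun i => algebraMap F k (c i)) (by
    simpa [algebraMap_smul] using h (δ.restrictScalars F))
  refine ⟨ν, (algebraMap F k).injective ?_, fun m h => hm m (hX.trans h)⟩
  rw [map_sum, map_zero, ← hν]
  simp

theorem exists_ratLinear_ne_zero {F : Type*} [Field F] [CharZero F] {a : F} (ha : a ≠ 0) :
    ∃ l : F →ₗ[ℚ] ℚ, l a ≠ 0 := by
  by_contra! h
  exact ha ((Module.forall_dual_apply_eq_zero_iff ℚ a).mp h)

/-- If `∑ cᵢ dlog zᵢ` is exact and not all the constants `cᵢ` vanish, then some nontrivial monomial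
in the `zᵢ` is algebraic over the field of constants. Its exponents are proportional to the values at
the `cᵢ` of a `ℚ`-linear functional, so they inherit every `ℤ`-linear relation between the `cᵢ`. -/
theorem exists_int_isAlgebraic_prod_zpow {F K ι : Type*} [Field F] [CharZero F] [Field K]
    [Algebra F K] [Fintype ι] {z : ι → K} (hz : ∀ i, z i ≠ 0) {v : K} {c : ι → F} (hc : c ≠ 0)
    (h : ∀ δ : Derivation F K K, ∑ i, c i • (δ (z i) / z i) = δ v) :
    ∃ m : ι → ℤ, m ≠ 0 ∧ IsAlgebraic F (∏ i, z i ^ m i) := by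
  obtain ⟨j, hj⟩ := Function.ne_iff.mp hc
  obtain ⟨l, hl⟩ := exists_ratLinear_ne_zero hj
  obtain ⟨b, hb⟩ := IsLocalization.exist_integer_multiples_of_finite (nonZeroDivisors ℤ)
    (fun i => l (c i))
  choose m hm using hb
  have hb0 : (b : ℤ) ≠ 0 := nonZeroDivisors.coe_ne_zero b
  have hm' (i) : (m i : ℚ) = b * l (c i) := by simpa using hm i
  refine ⟨m, fun h0 => ?_, by_contra fun htr => ?_⟩
  · have := hm' j
    rw [h0] at this
    simp [hl] at this
  · obtain ⟨ν, hν, hmν⟩ := exists_int_residues_of_transcendental htr hz h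
    apply hmν m rfl
    have h1 := congrArg l hν
    have h2 (i) : l (c i * ν i) = l (c i) * ν i := by
      rw [mul_comm, ← zsmul_eq_mul, map_zsmul, zsmul_eq_mul, mul_comm]
    rw [map_sum, map_zero] at h1
    simp only [h2] at h1
    have h3 : ((∑ i, m i * ν i : ℤ) : ℚ) = b * ∑ i, l (c i) * ν i := by
      push_cast
      rw [Finset.mul_sum]
      exact Finset.sum_congr rfl fun i _ => by rw [hm', mul_assoc]
    rw [h1, mul_zero] at h3
    exact_mod_cast h3

theorem Derivation.eq_zero_of_isAlgebraic {F K : Type*} [Field F] [CharZero F] [Field K]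
    [Algebra F K] (d : Derivation F K K) {x : K} (hx : IsAlgebraic F x) : d x = 0 := by
  have h1 : d (Polynomial.aeval x (minpoly F x)) = _ := d.map_aeval _ x
  rw [minpoly.aeval, map_zero] at h1
  have h2 : Polynomial.aeval x (minpoly F x).derivative ≠ 0 :=
    (minpoly.irreducible hx.isIntegral).separable.aeval_derivative_ne_zero (minpoly.aeval F x)
  simpa [h2] using h1.symm

/-! ### Linear relations with constant coefficients -/

/-- A nonzero subspace of `Kⁿ` stable under a derivation contains a nonzero vector of constants. -/
theorem exists_constant_vector {F K ι : Type*} [Field F] [Field K] [Algebra F K] [Fintype ι]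
    (D : Derivation F K K) (W : Submodule K (ι → K)) (hW : ∀ w ∈ W, (fun i => D (w i)) ∈ W)
    (hW0 : W ≠ ⊥) : ∃ w ∈ W, w ≠ 0 ∧ ∀ i, D (w i) = 0 := by
  classical
  obtain ⟨w₀, hw₀, hw₀0⟩ := W.ne_bot_iff.mp hW0
  let s : (ι → K) → ℕ := fun w => (Finset.univ.filter fun i => w i ≠ 0).card
  let S : Set (ι → K) := {w | w ∈ W ∧ w ≠ 0}
  -- Normalise a vector of minimal support to have an entry `1`: its derivative has smaller support.
  obtain ⟨w, ⟨hw, hw0⟩, hmin⟩ := exists_minimalFor_of_wellFoundedLT (· ∈ S) s ⟨w₀, hw₀, hw₀0⟩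
  obtain ⟨j, hj⟩ := Function.ne_iff.mp hw0
  simp only [Pi.zero_apply] at hj
  let w' : ι → K := (w j)⁻¹ • w
  have hw' : w' ∈ W := W.smul_mem _ hw
  have hw'j : w' j = 1 := inv_mul_cancel₀ hj
  refine ⟨w', hw', fun h => by simp [h] at hw'j, fun i => ?_⟩
  by_contra hi
  have hlt : s (fun i => D (w' i)) < s w := by
    refine Finset.card_lt_card ⟨fun i hi => ?_, fun hsub => ?_⟩
    · simp only [Finset.mem_filter, Finset.mem_univ, true_and] at hi ⊢
      intro h0
      apply hi
      change D ((w j)⁻¹ * w i) = 0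
      simp [h0]
    · have := hsub (Finset.mem_filter.mpr ⟨Finset.mem_univ j, hj⟩)
      simp [hw'j] at this
  exact absurd (hmin (j := fun i => D (w' i)) ⟨hW _ hw', fun h => hi (congrFun h i)⟩ hlt.le)
    hlt.not_ge

/-- The map sending a derivation `δ` to the vector `(δ yᵢ - δ zᵢ / zᵢ)ᵢ`, that is, evaluation of `δ`
at the differential forms `dyᵢ - dzᵢ / zᵢ`. -/
noncomputable def logDifferential {F K ι : Type*} [Field F] [Field K] [Algebra F K] (y z : ι → K) :
    Derivation F K K →ₗ[K] (ι → K) where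
  toFun δ i := δ (y i) - δ (z i) / z i
  map_add' δ ε := by
    ext i
    simp only [Derivation.add_apply, Pi.add_apply]
    ring
  map_smul' a δ := by
    ext i
    simp only [Derivation.smul_apply, Pi.smul_apply, smul_eq_mul, RingHom.id_apply]
    ring

/-- The forms `dyᵢ - dzᵢ / zᵢ` are invariant under the flow of a derivation `D` with
`D zᵢ = zᵢ D yᵢ`. -/
theorem logDifferential_lie {F K ι : Type*} [Field F] [Field K] [Algebra F K] {y z : ι → K}
    (hz : ∀ i, z i ≠ 0) {D : Derivation F K K} (hD : ∀ i, D (z i) = z i * D (y i))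
    (δ : Derivation F K K) (i : ι) :
    logDifferential y z ⁅D, δ⁆ i = D (logDifferential y z δ i) := by
  have := hz i
  simp only [logDifferential, LinearMap.coe_mk, AddHom.coe_mk, Derivation.commutator_apply, map_sub,
    hD, Derivation.leibniz_div, Derivation.leibniz, smul_eq_mul]
  field_simp
  ring

/-- A derivation vanishing on a transcendence basis of a subfield `K₀` vanishes on `K₀`. -/
theorem Derivation.eq_zero_of_isTranscendenceBasis {F K₀ K ι : Type*} [Field F] [CharZero F]
    [Field K₀] [Field K] [Algebra F K₀] [Algebra F K] [Algebra K₀ K] [IsScalarTower F K₀ K]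
    {x : ι → K₀} (hx : IsTranscendenceBasis F x) {δ : Derivation F K K}
    (hδ : ∀ i, δ (algebraMap K₀ K (x i)) = 0) (b : K₀) : δ (algebraMap K₀ K b) = 0 := by
  have := hx.isAlgebraic
  have : FaithfulSMul (Algebra.adjoin F (Set.range x)) K₀ :=
    (faithfulSMul_iff_algebraMap_injective _ _).mpr Subtype.val_injective
  have : CharZero (Algebra.adjoin F (Set.range x)) :=
    charZero_of_injective_algebraMap (algebraMap F _).injective
  have := Algebra.FormallyEtale.of_isAlgebraic_of_charZero (Algebra.adjoin F (Set.range x)) K₀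
  have h0 (a : Algebra.adjoin F (Set.range x)) : δ (algebraMap K₀ K a) = 0 := by
    obtain ⟨a, ha⟩ := a
    induction ha using Algebra.adjoin_induction with
    | mem a ha => obtain ⟨i, rfl⟩ := ha; exact hδ i
    | algebraMap r =>
      change δ (algebraMap K₀ K (algebraMap F K₀ r)) = 0
      rw [← IsScalarTower.algebraMap_apply, δ.map_algebraMap]
    | add a b ha hb iha ihb => simp_all
    | mul a b ha hb iha ihb => simp_all
  exact (comp_algHom_eq_of_formallyUnramified (A := Algebra.adjoin F (Set.range x))
    0 δ (IsScalarTower.toAlgHom F K₀ K) (fun a => by simpa using (h0 a).symm) b).symm.trans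
      (map_zero _)

/-- The image of `logDifferential` is a proper subspace: the map factors through evaluation at a
transcendence basis of `K₀`, and it kills a derivation `D` that is nonzero on `K₀`. -/
theorem finrank_range_logDifferential_lt {F K₀ K ι : Type*} [Field F] [CharZero F]
    [Field K₀] [Field K] [Algebra F K₀] [Algebra F K] [Algebra K₀ K] [IsScalarTower F K₀ K]
    [Fintype ι] {y z : ι → K₀} {D : Derivation F K K}
    (hD : logDifferential (F := F) (algebraMap K₀ K ∘ y) (algebraMap K₀ K ∘ z) D = 0)
    (hD0 : ∃ a, D (algebraMap K₀ K a) ≠ 0) (htr : Algebra.trdeg F K₀ ≤ Fintype.card ι) :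
    Module.finrank K (LinearMap.range (logDifferential (F := F) (algebraMap K₀ K ∘ y)
      (algebraMap K₀ K ∘ z))) < Fintype.card ι := by
  obtain ⟨t, ht⟩ := exists_isTranscendenceBasis F K₀
  rw [← ht.cardinalMk_eq_trdeg] at htr
  have : Finite {x // x ∈ t} :=
    Cardinal.mk_lt_aleph0_iff.mp (htr.trans_lt Cardinal.natCast_lt_aleph0)
  have := Fintype.ofFinite {x // x ∈ t}
  rw [Cardinal.mk_fintype, Nat.cast_le] at htr
  let Φ := logDifferential (F := F) (algebraMap K₀ K ∘ y) (algebraMap K₀ K ∘ z)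
  let ev : Derivation F K K →ₗ[K] ({x // x ∈ t} → K) :=
    { toFun := fun δ i => δ (algebraMap K₀ K i)
      map_add' := fun _ _ => rfl
      map_smul' := fun _ _ => rfl }
  have hev {δ} (hδ : ev δ = 0) (b : K₀) : δ (algebraMap K₀ K b) = 0 :=
    Derivation.eq_zero_of_isTranscendenceBasis ht (congrFun hδ) b
  have hle : LinearMap.ker ev ≤ LinearMap.ker Φ := fun δ hδ => by
    ext i
    simp [Φ, logDifferential, hev hδ]
  let e := ev.quotKerEquivRange
  have : Module.Finite K (Derivation F K K ⧸ LinearMap.ker ev) := Module.Finite.equiv e.symm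
  have h1 := LinearMap.finrank_range_add_finrank_ker ((LinearMap.ker ev).liftQ Φ hle)
  have h2 : 0 < Module.finrank K (LinearMap.ker ((LinearMap.ker ev).liftQ Φ hle)) := by
    rw [Module.finrank_pos_iff_exists_ne_zero]
    refine ⟨⟨Submodule.Quotient.mk D, hD⟩, fun h => ?_⟩
    obtain ⟨a, ha⟩ := hD0
    exact ha (hev ((Submodule.Quotient.mk_eq_zero _).mp (congrArg Subtype.val h)) a)
  have h3 : Module.finrank K (Derivation F K K ⧸ LinearMap.ker ev) ≤
      Fintype.card {x // x ∈ t} := by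
    rw [e.finrank_eq, ← Module.finrank_fintype_fun_eq_card K]
    exact Submodule.finrank_le _
  rw [Submodule.range_liftQ] at h1
  change Module.finrank K (LinearMap.range Φ) < _
  omega

/-! ### Ax's theorem -/

/-- **Ax's theorem** for one derivation: if `K₀` contains solutions of `D zᵢ = zᵢ D yᵢ` and has
transcendence degree at most the number of pairs `(yᵢ, zᵢ)` over the field of constants, then some
nontrivial integer combination of the `yᵢ` is constant. -/
theorem exists_int_combination_constant {F K₀ K ι : Type*} [Field F] [CharZero F]
    [Field K₀] [Field K] [Algebra F K₀] [Algebra F K] [Algebra K₀ K] [IsScalarTower F K₀ K]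
    [Fintype ι] {y z : ι → K₀} (hz : ∀ i, z i ≠ 0) {D : Derivation F K K}
    (hD : ∀ i, D (algebraMap K₀ K (z i)) = algebraMap K₀ K (z i) * D (algebraMap K₀ K (y i)))
    (hconst : ∀ a, D a = 0 → ∃ c, algebraMap F K c = a)
    (hD0 : ∃ a, D (algebraMap K₀ K a) ≠ 0) (htr : Algebra.trdeg F K₀ ≤ Fintype.card ι) :
    ∃ m : ι → ℤ, m ≠ 0 ∧ D (algebraMap K₀ K (∑ i, m i * y i)) = 0 := by
  classical
  let Y := algebraMap K₀ K ∘ y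
  let Z := algebraMap K₀ K ∘ z
  have hZ (i) : Z i ≠ 0 := (map_ne_zero (algebraMap K₀ K)).mpr (hz i)
  replace hD (i) : D (Z i) = Z i * D (Y i) := hD i
  let Φ := logDifferential (F := F) Y Z
  have hker : Φ D = 0 := by
    ext i
    simp [Φ, logDifferential, hD, mul_div_cancel_left₀ _ (hZ i)]
  have hlt : Module.finrank K (LinearMap.range Φ) < Module.finrank K (ι → K) := by
    rw [Module.finrank_fintype_fun_eq_card]
    exact finrank_range_logDifferential_lt hker hD0 htr
  -- The space of linear relations satisfied by the image of `Φ`.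
  let W : Submodule K (ι → K) :=
    { carrier := {w | ∀ δ, ∑ i, w i * Φ δ i = 0}
      add_mem' := fun ha hb δ => by simp [add_mul, Finset.sum_add_distrib, ha δ, hb δ]
      zero_mem' := fun δ => by simp
      smul_mem' := fun a w hw δ => by simp [mul_assoc, ← Finset.mul_sum, hw δ] }
  have hW0 : W ≠ ⊥ := by
    obtain ⟨f, hf0, hf⟩ := Submodule.exists_le_ker_of_lt_top (LinearMap.range Φ)
      (lt_top_iff_ne_top.mpr fun h => by
        rw [h, finrank_top] at hlt
        exact lt_irrefl _ hlt)
    have hfsum (w : ι → K) : f w = ∑ i, f (Pi.single i 1) * w i := by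
      conv_lhs => rw [← Finset.univ_sum_single w, map_sum]
      refine Finset.sum_congr rfl fun i _ => ?_
      rw [mul_comm, ← smul_eq_mul, ← map_smul, ← Pi.single_smul, smul_eq_mul, mul_one]
    refine W.ne_bot_iff.mpr ⟨fun i => f (Pi.single i 1), fun δ => ?_, fun h => hf0 ?_⟩
    · rw [← hfsum]
      exact hf ⟨δ, rfl⟩
    · exact LinearMap.ext fun w => (hfsum w).trans (by simp [fun i => congrFun h i])
  have hWD (w) (hw : w ∈ W) : (fun i => D (w i)) ∈ W := fun δ => by
    -- Apply `D` to the relation for `δ` and subtract the relation for `⁅D, δ⁆`.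
    have h1 := congrArg D (hw δ)
    have h2 := hw ⁅D, δ⁆
    simp only [Φ, logDifferential_lie hZ hD] at h2
    simp only [map_sum, map_zero, Derivation.leibniz, smul_eq_mul, Finset.sum_add_distrib] at h1
    rw [h2, zero_add] at h1
    rw [← h1]
    exact Finset.sum_congr rfl fun i _ => mul_comm _ _
  obtain ⟨w, hw, hw0, hconst'⟩ := exists_constant_vector D W hWD hW0
  choose c hc using fun i => hconst (w i) (hconst' i)
  have hc0 : c ≠ 0 := fun h => hw0 (by ext i; simp [← hc, h])
  obtain ⟨m, hm0, hm⟩ := exists_int_isAlgebraic_prod_zpow hZ hc0 (v := ∑ i, c i • Y i) fun δ => by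
    have h1 := hw δ
    simp only [← hc, ← Algebra.smul_def] at h1
    rw [map_sum, ← sub_eq_zero, ← neg_eq_zero, ← h1, ← Finset.sum_sub_distrib,
      ← Finset.sum_neg_distrib]
    refine Finset.sum_congr rfl fun i _ => ?_
    rw [Derivation.map_smul, ← smul_sub, ← smul_neg, neg_sub]
    rfl
  refine ⟨m, hm0, ?_⟩
  have h1 := D.div_self_prod Finset.univ (x := fun i => Z i ^ m i) fun i => zpow_ne_zero _ (hZ i)
  rw [D.eq_zero_of_isAlgebraic hm, zero_div] at h1
  rw [map_sum, map_sum]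
  refine Eq.trans ?_ h1.symm
  refine Finset.sum_congr rfl fun i _ => ?_
  rw [D.div_self_zpow (hZ i), hD, mul_div_cancel_left₀ _ (hZ i), ← zsmul_eq_mul, ← zsmul_eq_mul,
    map_zsmul, map_zsmul]
  rfl

open Polynomial in
/-- Ax's theorem over `C(t)`, inside any model `L` of the field of Laurent series. -/
theorem natCast_le_trdeg_adjoin.{u} {C L : Type u} [Field C] [CharZero C] [Field L]
    [Algebra (PowerSeries C) L] [IsFractionRing (PowerSeries C) L] [Algebra (RatFunc C) L]
    (hcomp : ∀ p : C[X], algebraMap (RatFunc C) L (algebraMap C[X] (RatFunc C) p) =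
      algebraMap (PowerSeries C) L p) {n : ℕ} {y z : Fin n → PowerSeries C}
    (hz : ∀ i, z i ≠ 0)
    (hyz : ∀ i, PowerSeries.derivative C (z i) = z i * PowerSeries.derivative C (y i))
    (hy : ∀ m : Fin n → ℤ, PowerSeries.derivative C (∑ i, m i * y i) = 0 → m = 0) :
    (n : Cardinal) ≤ Algebra.trdeg (RatFunc C) (IntermediateField.adjoin (RatFunc C)
      (Set.range (fun i => algebraMap (PowerSeries C) L (y i)) ∪
        Set.range (fun i => algebraMap (PowerSeries C) L (z i)))) := by
  let K₀ := IntermediateField.adjoin (RatFunc C)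
      (Set.range (fun i => algebraMap (PowerSeries C) L (y i)) ∪
        Set.range (fun i => algebraMap (PowerSeries C) L (z i)))
  let : Algebra C L :=
    ((algebraMap (PowerSeries C) L).comp (algebraMap C (PowerSeries C))).toAlgebra
  have : IsScalarTower C (PowerSeries C) L := .of_algebraMap_eq fun _ => rfl
  have : IsScalarTower C (RatFunc C) L := .of_algebraMap_eq fun c => by
    rw [IsScalarTower.algebraMap_apply C C[X] (RatFunc C), hcomp, ← Polynomial.C_eq_algebraMap,
      Polynomial.coe_C]
    rfl
  have : IsScalarTower C K₀ L := .of_algebraMap_eq fun _ => rfl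
  by_contra! hlt
  have htr : Algebra.trdeg C K₀ ≤ Fintype.card (Fin n) := by
    -- `C(t)` contributes one to the transcendence degree over `C`.
    have h1 : Algebra.trdeg C (RatFunc C) = 1 := by
      have : Algebra.IsAlgebraic C[X] (RatFunc C) :=
        IsLocalization.isAlgebraic (RatFunc C) (nonZeroDivisors C[X])
      rw [← trdeg_add_eq C C[X], Polynomial.trdeg_of_isDomain, trdeg_eq_zero, add_zero]
    obtain ⟨r, -, hr⟩ := Cardinal.exists_nat_eq_of_le_nat hlt.le
    rw [← trdeg_add_eq C (RatFunc C), h1, hr, Fintype.card_fin]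
    rw [hr, Nat.cast_lt] at hlt
    exact_mod_cast (by omega : 1 + r ≤ n)
  have : Algebra.FormallyEtale (PowerSeries C) L :=
    .of_isLocalization (nonZeroDivisors (PowerSeries C))
  obtain ⟨D, hD⟩ := Derivation.exists_extension_of_formallyEtale (B := L) (PowerSeries.derivative C)
  have hconst (a : L) (ha : D a = 0) : ∃ c, algebraMap C L c = a := by
    obtain ⟨d, hd⟩ := exists_derivation_fractionRing_powerSeries C
    have : Algebra.FormallyEtale (PowerSeries C) (FractionRing (PowerSeries C)) :=
      .of_isLocalization (nonZeroDivisors (PowerSeries C))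
    let e := (FractionRing.algEquiv (PowerSeries C) L).restrictScalars C
    have he (b) : e (d b) = D (e b) :=
      Derivation.comp_algHom_eq_of_formallyUnramified (A := PowerSeries C) d D e.toAlgHom
        (fun g => by
          rw [hd]
          change (FractionRing.algEquiv (PowerSeries C) L) _ =
            D ((FractionRing.algEquiv (PowerSeries C) L) _)
          rw [AlgEquiv.commutes, AlgEquiv.commutes, hD]) b
    obtain ⟨c, hc⟩ := exists_algebraMap_eq_of_derivation_eq_zero hd (f := e.symm a) (by
      apply e.injective
      rw [he, e.apply_symm_apply, ha, map_zero])
    exact ⟨c, by rw [← e.commutes, hc, e.apply_symm_apply]⟩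
  have hyK (i) : algebraMap (PowerSeries C) L (y i) ∈ K₀ :=
    IntermediateField.subset_adjoin _ _ (Or.inl ⟨i, rfl⟩)
  have hzK (i) : algebraMap (PowerSeries C) L (z i) ∈ K₀ :=
    IntermediateField.subset_adjoin _ _ (Or.inr ⟨i, rfl⟩)
  obtain ⟨m, hm0, hm⟩ := exists_int_combination_constant (F := C) (K₀ := K₀) (K := L)
    (y := fun i => ⟨_, hyK i⟩) (z := fun i => ⟨_, hzK i⟩) (D := D)
    (fun i h => hz i <| (FaithfulSMul.algebraMap_eq_zero_iff (PowerSeries C) L).mp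
      (congrArg Subtype.val h))
    (fun i => by
      change D (algebraMap _ L (z i)) = algebraMap _ L (z i) * D (algebraMap _ L (y i))
      rw [hD, hD, hyz, map_mul])
    hconst ⟨algebraMap (RatFunc C) K₀ RatFunc.X, by
      rw [← IsScalarTower.algebraMap_apply, ← RatFunc.algebraMap_X, hcomp, hD, Polynomial.coe_X,
        PowerSeries.derivative_X, map_one]
      exact one_ne_zero⟩ htr
  refine hm0 (hy m ?_)
  apply FaithfulSMul.algebraMap_injective (PowerSeries C) L
  rw [← hD, map_zero, ← hm]
  simp only [map_sum, map_mul, map_intCast]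
  rfl

theorem theorem3p1 (n : ℕ) (y : Fin n → PowerSeries ℂ)
    (hy₀ : ∀ i, PowerSeries.constantCoeff (y i) = 0)
    (hy : LinearIndependent ℚ y) :
    (n : Cardinal) ≤ Algebra.trdeg (RatFunc ℂ)
      (IntermediateField.adjoin (RatFunc ℂ)
        (Set.range (fun i => (y i : LaurentSeries ℂ)) ∪
          Set.range (fun i => (expSeries (y i) : LaurentSeries ℂ)))) := by
  have hsubst (i) : PowerSeries.HasSubst (y i) :=
    PowerSeries.HasSubst.of_constantCoeff_zero' (hy₀ i)
  have hexp (i) : PowerSeries.derivative ℂ (expSeries (y i)) =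
      expSeries (y i) * PowerSeries.derivative ℂ (y i) := by
    rw [expSeries, PowerSeries.derivative_subst (hsubst i), PowerSeries.derivative_exp]
  have hexp0 (i) : expSeries (y i) ≠ 0 := by
    intro h
    have hunit : IsUnit (PowerSeries.exp ℂ) := PowerSeries.isUnit_iff_constantCoeff.mpr (by simp)
    have := hunit.map (PowerSeries.substAlgHom (R := ℂ) (hsubst i))
    rw [PowerSeries.coe_substAlgHom] at this
    exact this.ne_zero h
  refine natCast_le_trdeg_adjoin (C := ℂ) (L := LaurentSeries ℂ) (fun p => ?_) hexp0 hexp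
    fun m hm => ?_
  · rw [← IsScalarTower.algebraMap_apply]
    rfl
  · have h0 : ∑ i, m i * y i = 0 := by
      apply PowerSeries.derivative.ext
      · rw [hm, map_zero]
      · simp [hy₀]
    have := Fintype.linearIndependent_iff.mp hy (fun i => m i) (by
      rw [← h0]
      refine Finset.sum_congr rfl fun i _ => ?_
      rw [Int.cast_smul_eq_zsmul, zsmul_eq_mul])
    ext i
    exact_mod_cast this i
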